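/- Let $p,q$ be integers with $0<p<q$ and $\gcd(p,q)=1$, and let $e\in\mathbb Z$. Let $L=L(1/2,1/2,p/q;e)$ be the $(2,2,r)$-Montesinos link, that is, the unoriented link obtained by arranging cyclically in a ring a row of $e$ right-handed half-twists (left-handed if $e<0$) and the three rational tangles with fractions $1/2$, $1/2$, $p/q$. Here the sign convention for fractions is that the one-crossing tangle whose overstrand joins the lower left to the upper right end point has fraction $+1$, and its mirror image, which is a single right-handed horizontal half-twist, has fraction $-1$ (so replacing a fraction $p_i/q_i$ by $p_i/q_i\pm1$ and simultaneously $e$ by $e\pm1$ does not change the link). The involutory quandle $Q_2(L)$ is the set with a binary operation $\rhd$ generated by the arcs of a diagram of $L$, subject to the axioms $x\rhd x=x$, $(x\rhd y)\rhd y=x$, $(x\rhd y)\rhd z=(x\rhd z)\rhd(y\rhd z)$, and to one relation $x_k\rhd x_j=x_i$ for each crossing, where $x_j$ is the overcrossing arc and $x_i,x_k$ are the two undercrossing arcs. Then $Q_2(L)$ is finite, and its order is $$|Q_2(L)| = 2(q+1)\,\bigl|(e-1)q-p\bigr|.$$ -/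

import Mathlib

/-! ## Link diagrams and involutory quandles -/

/-- A crossing of an unoriented diagram whose arcs are labelled by `α`: the arc that passes over,
and the two arcs on its two sides that end at the crossing, passing under. -/
structure Crossing (α : Type) where
  overstrand : α
  under₁ : α
  under₂ : α

/-- Relabel the arcs at a crossing. -/
def Crossing.map {α β : Type} (f : α → β) (c : Crossing α) : Crossing β where
  overstrand := f c.overstrand
  under₁ := f c.under₁
  under₂ := f c.under₂

/-- The data of an unoriented link diagram from which its involutory quandle is read off:
its arcs and its crossings. -/
structure LinkDiagram where
  Arc : Type
  crossings : List (Crossing Arc)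

/-- Formal expressions in generators `α` and one binary operation `x ▷ y`. -/
inductive QuandleTerm (α : Type) : Type
  | gen (a : α) : QuandleTerm α
  | op (x y : QuandleTerm α) : QuandleTerm α

namespace LinkDiagram

/-- The relations of the involutory quandle of a diagram: the axioms of an involutory quandle,
and for each crossing the relation `under₁ ▷ overstrand = under₂`. (The quotient below is by the
equivalence relation that these generate.) -/
inductive Rel (D : LinkDiagram) : QuandleTerm D.Arc → QuandleTerm D.Arc → Prop
  | idem (x : QuandleTerm D.Arc) : Rel D (.op x x) x
  | invol (x y : QuandleTerm D.Arc) : Rel D (.op (.op x y) y) x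
  | distrib (x y z : QuandleTerm D.Arc) :
      Rel D (.op (.op x y) z) (.op (.op x z) (.op y z))
  | crossing (c : Crossing D.Arc) (hc : c ∈ D.crossings) :
      Rel D (.op (.gen c.under₁) (.gen c.overstrand)) (.gen c.under₂)
  | congr_left {x x' : QuandleTerm D.Arc} (y : QuandleTerm D.Arc) (h : Rel D x x') :
      Rel D (.op x y) (.op x' y)
  | congr_right (x : QuandleTerm D.Arc) {y y' : QuandleTerm D.Arc} (h : Rel D y y') :
      Rel D (.op x y) (.op x y')

/-- The involutory quandle `Q₂(D)`: generated by the arcs of `D`, with one relation for each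
crossing. -/
def InvolutoryQuandle (D : LinkDiagram) : Type := Quot D.Rel

namespace InvolutoryQuandle

/-- The operation `x ▷ y`. -/
def op {D : LinkDiagram} : D.InvolutoryQuandle → D.InvolutoryQuandle → D.InvolutoryQuandle :=
  Quot.map₂ QuandleTerm.op (fun x _ _ h => .congr_right x h) (fun _ _ y h => .congr_left y h)

theorem op_op_self {D : LinkDiagram} (x y : D.InvolutoryQuandle) : op (op x y) y = x := by
  induction x using Quot.ind
  induction y using Quot.ind
  exact Quot.sound (.invol _ _)

/-- `Q₂(D)` is a quandle; Mathlib writes `x ▷ y` as `y ◃ x`. -/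
instance (D : LinkDiagram) : Quandle D.InvolutoryQuandle where
  act x y := op y x
  self_distrib := by
    intro x y z
    induction x using Quot.ind
    induction y using Quot.ind
    induction z using Quot.ind
    exact Quot.sound (.distrib _ _ _)
  invAct x y := op y x
  left_inv x y := op_op_self y x
  right_inv x y := op_op_self y x
  fix := by
    intro x
    induction x using Quot.ind
    exact Quot.sound (.idem _)

/-- The quandle `Q₂(D)` is involutory. -/
theorem isInvolutory (D : LinkDiagram) : Rack.IsInvolutory D.InvolutoryQuandle :=
  fun x y => op_op_self y x

end InvolutoryQuandle

end LinkDiagram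

/-! ## Tangle diagrams -/

/-- The four end points of a tangle diagram. -/
inductive Corner
  | NW | NE | SW | SE

/-- Planar diagrams of two-string tangles, built from the trivial tangles and single crossings.
* `zero`: two parallel horizontal strands;
* `infty`: two parallel vertical strands;
* `pos`: one crossing, whose overstrand joins the corners SW and NE;
* `neg`: one crossing, whose overstrand joins the corners NW and SE;
* `hsum S T`: `S` to the left of `T`, the right ends of `S` joined to the left ends of `T`;
* `vsum S T`: `S` on top of `T`, the lower ends of `S` joined to the upper ends of `T`. -/
inductive TangleDiagram
  | zero | infty | pos | neg
  | hsum (S T : TangleDiagram)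
  | vsum (S T : TangleDiagram)

/-- The two strands of a diagram without crossings:
`fst` is the upper one of `zero` and the left one of `infty`. -/
inductive TwoStrands
  | fst | snd

/-- The three arcs of a diagram with one crossing. -/
inductive CrossingArcs
  | overstrand | upper | lower

namespace TangleDiagram

/-- The arcs of the elementary pieces of which a tangle diagram is composed. -/
@[reducible] def Piece : TangleDiagram → Type
  | zero => TwoStrands
  | infty => TwoStrands
  | pos => CrossingArcs
  | neg => CrossingArcs
  | hsum S T => Piece S ⊕ Piece T
  | vsum S T => Piece S ⊕ Piece T

/-- The piece that ends at a given corner. -/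
def corner : (T : TangleDiagram) → Corner → T.Piece
  | zero, .NW => .fst
  | zero, .NE => .fst
  | zero, .SW => .snd
  | zero, .SE => .snd
  | infty, .NW => .fst
  | infty, .SW => .fst
  | infty, .NE => .snd
  | infty, .SE => .snd
  | pos, .SW => .overstrand
  | pos, .NE => .overstrand
  | pos, .NW => .upper
  | pos, .SE => .lower
  | neg, .NW => .overstrand
  | neg, .SE => .overstrand
  | neg, .NE => .upper
  | neg, .SW => .lower
  | hsum S _, .NW => .inl (corner S .NW)
  | hsum S _, .SW => .inl (corner S .SW)
  | hsum _ T, .NE => .inr (corner T .NE)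
  | hsum _ T, .SE => .inr (corner T .SE)
  | vsum S _, .NW => .inl (corner S .NW)
  | vsum S _, .NE => .inl (corner S .NE)
  | vsum _ T, .SW => .inr (corner T .SW)
  | vsum _ T, .SE => .inr (corner T .SE)

/-- The pairs of pieces whose ends are joined inside the tangle diagram. -/
def joins : (T : TangleDiagram) → List (T.Piece × T.Piece)
  | zero => []
  | infty => []
  | pos => []
  | neg => []
  | hsum S T =>
      (joins S).map (Prod.map Sum.inl Sum.inl) ++ (joins T).map (Prod.map Sum.inr Sum.inr) ++
        [(.inl (corner S .NE), .inr (corner T .NW)), (.inl (corner S .SE), .inr (corner T .SW))]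
  | vsum S T =>
      (joins S).map (Prod.map Sum.inl Sum.inl) ++ (joins T).map (Prod.map Sum.inr Sum.inr) ++
        [(.inl (corner S .SW), .inr (corner T .NW)), (.inl (corner S .SE), .inr (corner T .NE))]

/-- The crossings of a tangle diagram. -/
def crossings : (T : TangleDiagram) → List (Crossing T.Piece)
  | zero => []
  | infty => []
  | pos => [⟨.overstrand, .upper, .lower⟩]
  | neg => [⟨.overstrand, .upper, .lower⟩]
  | hsum S T =>
      (crossings S).map (Crossing.map Sum.inl) ++ (crossings T).map (Crossing.map Sum.inr)
  | vsum S T =>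
      (crossings S).map (Crossing.map Sum.inl) ++ (crossings T).map (Crossing.map Sum.inr)

/-- Two pieces meet in the numerator closure of `T`, the link diagram in which NW is joined to NE
and SW is joined to SE. -/
def ClosureJoin (T : TangleDiagram) (a b : T.Piece) : Prop :=
  (a, b) ∈ T.joins ∨ (a = T.corner .NW ∧ b = T.corner .NE) ∨
    (a = T.corner .SW ∧ b = T.corner .SE)

/-- The numerator closure of a tangle diagram. Its arcs are the unions of the pieces that are
joined to each other. -/
def numeratorClosure (T : TangleDiagram) : LinkDiagram where
  Arc := Quot T.ClosureJoin
  crossings := T.crossings.map (Crossing.map (Quot.mk T.ClosureJoin))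

/-- `IsRational T a b`: the diagram `T` arises from a trivial tangle by adding single crossings
on the right, on the left, at the bottom or at the top, and `a / b` is the fraction of the tangle,
computed by the rules `F(0) = 0`, `F(∞) = ∞`, `F(T + [±1]) = F([±1] + T) = F(T) ± 1`,
`1 / F(T * [±1]) = 1 / F([±1] * T) = 1 / F(T) ± 1`. -/
inductive IsRational : TangleDiagram → ℤ → ℤ → Prop
  | zero : IsRational zero 0 1
  | infty : IsRational infty 1 0
  | right_pos {T : TangleDiagram} {a b : ℤ} (h : IsRational T a b) :
      IsRational (hsum T pos) (a + b) b
  | right_neg {T : TangleDiagram} {a b : ℤ} (h : IsRational T a b) :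
      IsRational (hsum T neg) (a - b) b
  | left_pos {T : TangleDiagram} {a b : ℤ} (h : IsRational T a b) :
      IsRational (hsum pos T) (a + b) b
  | left_neg {T : TangleDiagram} {a b : ℤ} (h : IsRational T a b) :
      IsRational (hsum neg T) (a - b) b
  | bottom_pos {T : TangleDiagram} {a b : ℤ} (h : IsRational T a b) :
      IsRational (vsum T pos) a (b + a)
  | bottom_neg {T : TangleDiagram} {a b : ℤ} (h : IsRational T a b) :
      IsRational (vsum T neg) a (b - a)
  | top_pos {T : TangleDiagram} {a b : ℤ} (h : IsRational T a b) :
      IsRational (vsum pos T) a (b + a)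
  | top_neg {T : TangleDiagram} {a b : ℤ} (h : IsRational T a b) :
      IsRational (vsum neg T) a (b - a)

/-- `T` is a diagram of the rational tangle with the (finite) fraction `r`. -/
def IsRationalTangle (T : TangleDiagram) (r : ℚ) : Prop :=
  ∃ a b : ℤ, T.IsRational a b ∧ b ≠ 0 ∧ r = (a : ℚ) / (b : ℚ)

/-- A horizontal row of `n` copies of `T`. -/
def row (T : TangleDiagram) : ℕ → TangleDiagram
  | 0 => zero
  | n + 1 => hsum (row T n) T

/-- A horizontal row of `e` right-handed half-twists (left-handed ones if `e < 0`).
In a right-handed half-twist of two horizontal strands the overstrand falls from NW to SE. -/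
def halfTwists (e : ℤ) : TangleDiagram :=
  if 0 ≤ e then row neg e.toNat else row pos (-e).toNat

/-- The diagram of a Montesinos link: `e` right-handed half-twists and the tangles `T₁`, `T₂`, `T₃`
arranged in this cyclic order in a ring. -/
def montesinos (T₁ T₂ T₃ : TangleDiagram) (e : ℤ) : LinkDiagram :=
  (hsum (halfTwists e) (hsum T₁ (hsum T₂ T₃))).numeratorClosure

end TangleDiagram

/-- `D` is a diagram of the Montesinos link `L(r₁, r₂, r₃; e)`, composed of diagrams of rational
tangles with fractions `r₁`, `r₂`, `r₃` and of `e` right-handed half-twists. -/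
def IsMontesinosDiagram (D : LinkDiagram) (r₁ r₂ r₃ : ℚ) (e : ℤ) : Prop :=
  ∃ T₁ T₂ T₃ : TangleDiagram, T₁.IsRationalTangle r₁ ∧ T₂.IsRationalTangle r₂ ∧
    T₃.IsRationalTangle r₃ ∧ D = TangleDiagram.montesinos T₁ T₂ T₃ e

/-! The dihedral quandle `ℤ`, with `i ▷ j = 2 * j - i`, is the free involutory quandle on two
generators. A rational tangle is grown from two free strands by crossings whose arcs are determined
by arcs already present. So each of its colourings is one dihedral sequence read off at integer
labels, and the corner labels differ by the numerator and denominator of the fraction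
(`IsRational.exists_isUniversalColoring`). Hence `Q₂(L)` is presented by four dihedral sequences `w,
x, y, z` (half-twists and three tangles), glued at corners. With `m = e * q - p`, the gluings
express everything through `z i` and `a l = y (2 * l)`: `w j = z (q * j + p)`, `x (2 * j) = z (q * j
- m)`, `y (2 * j + 1) = z (q * j)`, `x (2 * j + 1) = a j`. Since `p` and `q` are coprime, every
index has the form `q * a + m * b`, and all products of the two families follow by reflections
(`op_z_y`, `op_y_z`). The expressions obtained depend on the pair `(a, b)`, so the relation `q * m =
m * q` forces period `2 * q * d` on `z` and `2 * d` on `a`, where `d = q - m`. No further collapse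
occurs: the resulting operation on the two cyclic families is an involutory quandle
(`PrismQuandle.isInvolutoryQuandleOp`) and receives a colouring of the diagram. Thus the order is `2
* q * |d| + 2 * |d|`. -/

/-! ## Involutory quandles and dihedral sequences -/

/-- The axioms of an involutory quandle, for a binary operation. -/
structure IsInvolutoryQuandleOp {X : Type} (op : X → X → X) : Prop where
  idem (x : X) : op x x = x
  invol (x y : X) : op (op x y) y = x
  distrib (x y z : X) : op (op x y) z = op (op x z) (op y z)

/-- A quandle homomorphism from the infinite dihedral quandle `ℤ`, in which
`i ▷ j = 2 * j - i`. -/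
def IsDihedral {X : Type} (op : X → X → X) (φ : ℤ → X) : Prop :=
  ∀ i j, φ (2 * j - i) = op (φ i) (φ j)

/-- The dihedral quandle `ℤ` is generated by `0` and `1`: from two neighbours, reflecting each in
the other extends the interval by one step on either side. -/
theorem Int.reflection_induction {P : ℤ → Prop} (h : ∀ i j, P i → P j → P (2 * j - i))
    (h0 : P 0) (h1 : P 1) (i : ℤ) : P i := by
  have key : ∀ n : ℕ, (P n ∧ P (n + 1)) ∧ (P (-n) ∧ P (-n + 1)) := by
    intro n
    induction n with
    | zero => simp [h0, h1]
    | succ n ih =>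
      obtain ⟨⟨a, b⟩, c, d⟩ := ih
      refine ⟨⟨by exact_mod_cast b, ?_⟩, ?_, ?_⟩
      · convert h _ _ a b using 1; push_cast; ring
      · convert h _ _ d c using 1; push_cast; ring
      · convert c using 1; push_cast; ring
  obtain ⟨n, rfl | rfl⟩ := Int.eq_nat_or_neg i
  · exact (key n).1.1
  · exact (key n).2.1

namespace IsDihedral

variable {X : Type} {op : X → X → X} {φ ψ : ℤ → X}

theorem comp_affine (h : IsDihedral op φ) (r s : ℤ) : IsDihedral op fun i => φ (r * i + s) := by
  intro i j
  dsimp only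
  rw [← h]
  congr 1
  ring

theorem ext (hφ : IsDihedral op φ) (hψ : IsDihedral op ψ) (h0 : φ 0 = ψ 0) (h1 : φ 1 = ψ 1)
    (i : ℤ) : φ i = ψ i :=
  Int.reflection_induction (P := fun i => φ i = ψ i)
    (fun i j hi hj => by rw [hφ, hψ, hi, hj]) h0 h1 i

end IsDihedral

namespace IsInvolutoryQuandleOp

variable {X : Type} {op : X → X → X}

/-- The symmetry `x ↦ x ▷ y`. -/
def symmetry (h : IsInvolutoryQuandleOp op) (y : X) : Equiv.Perm X where
  toFun x := op x y
  invFun x := op x y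
  left_inv x := h.invol x y
  right_inv x := h.invol x y

/-- This is the freeness of `ℤ` on `0` and `1`. The product `τ` of the symmetries at `u` and `v`
must act as translation by `2`, which dictates `φ (2 * k) = τ ^ k u` and `φ (2 * k + 1) = τ ^ k v`.
-/
theorem exists_isDihedral (h : IsInvolutoryQuandleOp op) (u v : X) :
    ∃ φ : ℤ → X, IsDihedral op φ ∧ φ 0 = u ∧ φ 1 = v := by
  set U := h.symmetry u with hU
  set V := h.symmetry v with hV
  have Ua : ∀ x, U x = op x u := fun _ => rfl
  have Va : ∀ x, V x = op x v := fun _ => rfl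
  set τ : Equiv.Perm X := V * U with hτ
  have UU : U * U = 1 := by ext x; exact h.invol x u
  have VV : V * V = 1 := by ext x; exact h.invol x v
  have Uinv : U⁻¹ = U := inv_eq_of_mul_eq_one_left UU
  have Vinv : V⁻¹ = V := inv_eq_of_mul_eq_one_left VV
  have τinv : τ⁻¹ = U * V := by rw [hτ, mul_inv_rev, Uinv, Vinv]
  have conj : ∀ k : ℤ, U * τ ^ k = τ ^ (-k) * U := by
    have h1 : U * τ * U⁻¹ = τ⁻¹ := by
      rw [τinv, Uinv, hτ, mul_assoc, mul_assoc, UU, mul_one]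
    intro k
    have h2 := conj_zpow (i := k) (a := U) (b := τ)
    rw [h1, inv_zpow, ← zpow_neg] at h2
    rw [h2, inv_mul_cancel_right]
  -- Right distributivity says that every symmetry is an automorphism.
  have aut : ∀ (k : ℤ) (x y : X), (τ ^ k) (op x y) = op ((τ ^ k) x) ((τ ^ k) y) := by
    have a1 : ∀ x y : X, τ (op x y) = op (τ x) (τ y) := fun x y => by
      simp only [hτ, Equiv.Perm.mul_apply, Ua, Va, h.distrib _ _ u, h.distrib _ _ v]
    have a2 : ∀ x y : X, τ⁻¹ (op x y) = op (τ⁻¹ x) (τ⁻¹ y) := fun x y => by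
      simp only [τinv, Equiv.Perm.mul_apply, Ua, Va, h.distrib _ _ u, h.distrib _ _ v]
    intro k
    induction k using Int.induction_on with
    | zero => intro x y; simp
    | succ n ih => intro x y; rw [zpow_add_one]; simp only [Equiv.Perm.mul_apply, a1, ih]
    | pred n ih => intro x y; rw [zpow_sub_one]; simp only [Equiv.Perm.mul_apply, a2, ih]
  set φ : ℤ → X := fun i => if Even i then (τ ^ (i / 2)) u else (τ ^ (i / 2)) v with hφ
  have even : ∀ k : ℤ, φ (2 * k) = (τ ^ k) u := fun k => by simp [hφ]
  have odd : ∀ k : ℤ, φ (2 * k + 1) = (τ ^ k) v := fun k => by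
    have : (2 * k + 1) / 2 = k := by omega
    simp [hφ, this]
  have shift : ∀ k i : ℤ, (τ ^ k) (φ i) = φ (2 * k + i) := by
    intro k i
    obtain ⟨j, rfl | rfl⟩ := Int.even_or_odd' i
    · rw [even, show 2 * k + 2 * j = 2 * (k + j) by ring, even, zpow_add, Equiv.Perm.mul_apply]
    · rw [odd, show 2 * k + (2 * j + 1) = 2 * (k + j) + 1 by ring, odd, zpow_add,
        Equiv.Perm.mul_apply]
  have reflU : ∀ i, op (φ i) u = φ (-i) := by
    intro i
    rw [← Ua]
    obtain ⟨j, rfl | rfl⟩ := Int.even_or_odd' i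
    · rw [even, ← Equiv.Perm.mul_apply, conj, Equiv.Perm.mul_apply, Ua, h.idem, ← even]
      congr 1; ring
    · rw [odd, ← Equiv.Perm.mul_apply, conj, Equiv.Perm.mul_apply,
        show -(2 * j + 1) = 2 * (-j + -1) + 1 by ring, odd, zpow_add, Equiv.Perm.mul_apply,
        zpow_neg_one, τinv, Equiv.Perm.mul_apply, Va, h.idem]
  have reflV : ∀ i, op (φ i) v = φ (2 - i) := by
    intro i
    have : op (φ i) v = τ (op (φ i) u) := by
      rw [hτ, Equiv.Perm.mul_apply, Ua, h.invol, Va]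
    rw [this, reflU, ← zpow_one τ, shift]
    congr 1
  refine ⟨φ, fun i j => ?_, by simpa using even 0, by simpa using odd 0⟩
  -- The automorphism `τ ^ k` moves the centre `j` of the reflection to `0` or `1`, where `reflU` or
  -- `reflV` applies.
  have back : ∀ k, φ i = (τ ^ k) (φ (i - 2 * k)) := fun k => by rw [shift]; congr 1; ring
  obtain ⟨k, rfl | rfl⟩ := Int.even_or_odd' j
  · rw [even, back k, ← aut, reflU, shift]; congr 1; ring
  · rw [odd, back k, ← aut, reflV, shift]; congr 1; ring

end IsInvolutoryQuandleOp

/-! ## The universal property of the involutory quandle -/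

/-- The value of a formal expression. -/
def QuandleTerm.eval {α X : Type} (op : X → X → X) (c : α → X) : QuandleTerm α → X
  | .gen a => c a
  | .op x y => op (x.eval op c) (y.eval op c)

namespace LinkDiagram

/-- Colourings of the arcs of a link diagram. -/
def IsColoring {X : Type} (op : X → X → X) (D : LinkDiagram) (c : D.Arc → X) : Prop :=
  ∀ k ∈ D.crossings, op (c k.under₁) (c k.overstrand) = c k.under₂

namespace InvolutoryQuandle

variable {D : LinkDiagram}

/-- The generator given by an arc. -/
def gen (a : D.Arc) : D.InvolutoryQuandle := Quot.mk _ (.gen a)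

theorem isInvolutoryQuandleOp : IsInvolutoryQuandleOp (op (D := D)) where
  idem := by rintro ⟨x⟩; exact Quot.sound (.idem x)
  invol := op_op_self
  distrib := by rintro ⟨x⟩ ⟨y⟩ ⟨z⟩; exact Quot.sound (.distrib x y z)

theorem isColoring_gen : IsColoring op D gen := fun k hk => Quot.sound (.crossing k hk)

theorem induction {P : D.InvolutoryQuandle → Prop} (hgen : ∀ a, P (gen a))
    (hop : ∀ x y, P x → P y → P (op x y)) (x : D.InvolutoryQuandle) : P x := by
  induction x using Quot.ind with
  | mk t =>
    induction t with
    | gen a => exact hgen a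
    | op x y hx hy => exact hop _ _ hx hy

/-- The homomorphism that extends a colouring. -/
def lift {X : Type} {o : X → X → X} (h : IsInvolutoryQuandleOp o) {c : D.Arc → X}
    (hc : IsColoring o D c) : D.InvolutoryQuandle → X :=
  Quot.lift (QuandleTerm.eval o c) (by
    intro s t hst
    induction hst with
    | idem x => exact h.idem _
    | invol x y => exact h.invol _ _
    | distrib x y z => exact h.distrib _ _ _
    | crossing k hk => exact hc k hk
    | congr_left y _ ih => simp only [QuandleTerm.eval, ih]
    | congr_right x _ ih => simp only [QuandleTerm.eval, ih])

theorem lift_op {X : Type} {o : X → X → X} (h : IsInvolutoryQuandleOp o) {c : D.Arc → X}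
    (hc : IsColoring o D c) (x y : D.InvolutoryQuandle) :
    lift h hc (op x y) = o (lift h hc x) (lift h hc y) := by
  induction x using Quot.ind
  induction y using Quot.ind
  rfl

end InvolutoryQuandle

end LinkDiagram

/-! ## Colourings of rational tangles -/

namespace TangleDiagram

/-- Colourings of the pieces of a tangle diagram that agree on joined pieces. -/
structure IsColoring {X : Type} (op : X → X → X) (T : TangleDiagram) (c : T.Piece → X) :
    Prop where
  join : ∀ a b, (a, b) ∈ T.joins → c a = c b
  crossing : ∀ k ∈ T.crossings, op (c k.under₁) (c k.overstrand) = c k.under₂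

theorem isColoring_hsum_iff {X : Type} {op : X → X → X} {S T : TangleDiagram}
    {c : (hsum S T).Piece → X} :
    IsColoring op (hsum S T) c ↔
      IsColoring op S (fun a => c (.inl a)) ∧ IsColoring op T (fun a => c (.inr a)) ∧
        c (.inl (S.corner .NE)) = c (.inr (T.corner .NW)) ∧
        c (.inl (S.corner .SE)) = c (.inr (T.corner .SW)) := by
  constructor
  · rintro ⟨hj, hk⟩
    refine ⟨⟨fun a b h => hj _ _ ?_, fun k h => hk (k.map Sum.inl) ?_⟩,
      ⟨fun a b h => hj _ _ ?_, fun k h => hk (k.map Sum.inr) ?_⟩, hj _ _ ?_, hj _ _ ?_⟩ <;>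
      simp [joins, crossings] <;> grind
  · rintro ⟨⟨hj, hk⟩, ⟨hj', hk'⟩, h1, h2⟩
    constructor
    · intro a b h
      simp [joins] at h
      grind
    · intro k h
      simp [crossings] at h
      obtain ⟨k, h, rfl⟩ | ⟨k, h, rfl⟩ := h
      · exact hk k h
      · exact hk' k h

theorem isColoring_vsum_iff {X : Type} {op : X → X → X} {S T : TangleDiagram}
    {c : (vsum S T).Piece → X} :
    IsColoring op (vsum S T) c ↔
      IsColoring op S (fun a => c (.inl a)) ∧ IsColoring op T (fun a => c (.inr a)) ∧
        c (.inl (S.corner .SW)) = c (.inr (T.corner .NW)) ∧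
        c (.inl (S.corner .SE)) = c (.inr (T.corner .NE)) := by
  constructor
  · rintro ⟨hj, hk⟩
    refine ⟨⟨fun a b h => hj _ _ ?_, fun k h => hk (k.map Sum.inl) ?_⟩,
      ⟨fun a b h => hj _ _ ?_, fun k h => hk (k.map Sum.inr) ?_⟩, hj _ _ ?_, hj _ _ ?_⟩ <;>
      simp [joins, crossings] <;> grind
  · rintro ⟨⟨hj, hk⟩, ⟨hj', hk'⟩, h1, h2⟩
    constructor
    · intro a b h
      simp [joins] at h
      grind
    · intro k h
      simp [crossings] at h
      obtain ⟨k, h, rfl⟩ | ⟨k, h, rfl⟩ := h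
      · exact hk k h
      · exact hk' k h

theorem isColoring_pos_iff {X : Type} {op : X → X → X} {c : pos.Piece → X} :
    IsColoring op pos c ↔ op (c .upper) (c .overstrand) = c .lower :=
  ⟨fun h => h.crossing ⟨_, _, _⟩ (List.mem_singleton_self _),
    fun h => ⟨by simp [joins], by simpa [crossings] using h⟩⟩

theorem isColoring_neg_iff {X : Type} {op : X → X → X} {c : neg.Piece → X} :
    IsColoring op neg c ↔ op (c .upper) (c .overstrand) = c .lower :=
  ⟨fun h => h.crossing ⟨_, _, _⟩ (List.mem_singleton_self _),
    fun h => ⟨by simp [joins], by simpa [crossings] using h⟩⟩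

/-- A function on the three arcs of a one-crossing diagram. -/
def crossingColors {X : Type} (o u l : X) : CrossingArcs → X
  | .overstrand => o
  | .upper => u
  | .lower => l

/-- By involutivity the crossing relation can be solved for either under-arc. Both alternatives of
`hul` occur, because an added crossing meets the old tangle at its upper or at its lower under-arc.
-/
theorem eq_crossingColors {X : Type} {op : X → X → X} (hop : IsInvolutoryQuandleOp op)
    {φ : ℤ → X} (hφ : IsDihedral op φ) {c : CrossingArcs → X} {o u l : ℤ} (hl : 2 * o - u = l)
    (hc : op (c .upper) (c .overstrand) = c .lower) (ho : c .overstrand = φ o)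
    (hul : c .upper = φ u ∨ c .lower = φ l) (t : CrossingArcs) :
    c t = φ (crossingColors o u l t) := by
  have h1 := hφ u o
  rw [hl] at h1
  cases t with
  | overstrand => exact ho
  | upper =>
    refine hul.elim id fun h => ?_
    rw [← hop.invol (c .upper) (c .overstrand), hc, h, ho, h1]
    exact hop.invol _ _
  | lower =>
    refine hul.elim (fun h => ?_) id
    rw [← hc, ho, h, ← h1]
    rfl

theorem isColoring_crossingColors {X : Type} {op : X → X → X} {φ : ℤ → X}
    (hφ : IsDihedral op φ) {o u l : ℤ} (hl : 2 * o - u = l) :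
    op (φ (crossingColors o u l .upper)) (φ (crossingColors o u l .overstrand)) =
      φ (crossingColors o u l .lower) := by
  subst hl
  exact (hφ u o).symm

/-- `n` is a colouring of `T` by the infinite dihedral quandle `ℤ` through which all colourings
by involutory quandles factor, and the colours of the corners are those of the fraction `a / b`. -/
structure IsUniversalColoring (T : TangleDiagram) (a b : ℤ) (n : T.Piece → ℤ) : Prop where
  isColoring {X : Type} {op : X → X → X} {φ : ℤ → X} (hφ : IsDihedral op φ) :
    IsColoring op T fun t => φ (n t)
  factors {X : Type} {op : X → X → X} (h : IsInvolutoryQuandleOp op) {c : T.Piece → X}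
    (hc : IsColoring op T c) : ∃ φ : ℤ → X, IsDihedral op φ ∧ ∀ t, c t = φ (n t)
  north_east : n (T.corner .NE) = n (T.corner .NW) + a
  south_west : n (T.corner .SW) = n (T.corner .NW) + b
  south_east : n (T.corner .SE) = n (T.corner .NW) + a + b

/-- This normalises the label of a corner and the common sign of numerator and denominator; `r * r =
1` makes the relabelling invertible. -/
theorem IsUniversalColoring.affine {T : TangleDiagram} {a b : ℤ} {n : T.Piece → ℤ}
    (h : T.IsUniversalColoring a b n) (r s : ℤ) (hr : r * r = 1) :
    T.IsUniversalColoring (r * a) (r * b) fun t => r * n t + s where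
  isColoring hφ := h.isColoring (hφ.comp_affine r s)
  factors hop c hc := by
    obtain ⟨φ, hφ, H⟩ := h.factors hop hc
    refine ⟨_, hφ.comp_affine r (-(r * s)), fun t => ?_⟩
    rw [H]
    congr 1
    linear_combination (-n t) * hr
  north_east := by rw [h.north_east]; ring
  south_west := by rw [h.south_west]; ring
  south_east := by rw [h.south_east]; ring

/-- A new crossing is glued to two corners of the old tangle by its overstrand and one under-arc, so
the same sequence `φ` colours it and the remaining label is a reflection. The corner differences
`(a, b)` then change exactly as the fraction does. -/
theorem IsRational.exists_isUniversalColoring {T : TangleDiagram} {a b : ℤ}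
(h : T.IsRational a b) : ∃ n, T.IsUniversalColoring a b n := by
  induction h with
  | zero =>
    refine ⟨fun | .fst => 0 | .snd => 1, fun _ => ⟨by simp [joins], by simp [crossings]⟩,
      fun hop c _ => ?_, rfl, rfl, rfl⟩
    obtain ⟨φ, hφ, h0, h1⟩ := hop.exists_isDihedral (c .fst) (c .snd)
    exact ⟨φ, hφ, fun | .fst => h0.symm | .snd => h1.symm⟩
  | infty =>
    refine ⟨fun | .fst => 0 | .snd => 1, fun _ => ⟨by simp [joins], by simp [crossings]⟩,
      fun hop c _ => ?_, rfl, rfl, rfl⟩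
    obtain ⟨φ, hφ, h0, h1⟩ := hop.exists_isDihedral (c .fst) (c .snd)
    exact ⟨φ, hφ, fun | .fst => h0.symm | .snd => h1.symm⟩
  | @right_pos T _ _ _ ih =>
    obtain ⟨n, hn⟩ := ih
    have h1 := hn.north_east
    have h2 := hn.south_west
    have h3 := hn.south_east
    refine ⟨Sum.elim n (crossingColors (n (T.corner .SE)) (n (T.corner .NE))
      (2 * n (T.corner .SE) - n (T.corner .NE))), fun hφ => ?_, fun hop c hc => ?_, ?_, ?_, ?_⟩
    · exact isColoring_hsum_iff.2 ⟨hn.isColoring hφ, isColoring_pos_iff.2 (isColoring_crossingColors hφ rfl),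
        rfl, rfl⟩
    · obtain ⟨hcT, hcC, hj, hj'⟩ := isColoring_hsum_iff.1 hc
      obtain ⟨φ, hφ, H⟩ := hn.factors hop hcT
      exact ⟨φ, hφ, Sum.rec H (eq_crossingColors hop hφ rfl (isColoring_pos_iff.1 hcC)
      (hj'.symm.trans (H _)) (.inl (hj.symm.trans (H _))))⟩
    all_goals simp only [corner, Sum.elim_inl, Sum.elim_inr, crossingColors]; linarith
  | @right_neg T _ _ _ ih =>
    obtain ⟨n, hn⟩ := ih
    have h1 := hn.north_east
    have h2 := hn.south_west
    have h3 := hn.south_east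
    -- Here the old tangle fixes the lower under-arc, so the upper one is its reflection.
    refine ⟨Sum.elim n (crossingColors (n (T.corner .NE)) (2 * n (T.corner .NE) - n (T.corner .SE))
      (n (T.corner .SE))), fun hφ => ?_, fun hop c hc => ?_, ?_, ?_, ?_⟩
    · exact isColoring_hsum_iff.2 ⟨hn.isColoring hφ, isColoring_neg_iff.2 (isColoring_crossingColors hφ (sub_sub_cancel _ _)),
        rfl, rfl⟩
    · obtain ⟨hcT, hcC, hj, hj'⟩ := isColoring_hsum_iff.1 hc
      obtain ⟨φ, hφ, H⟩ := hn.factors hop hcT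
      exact ⟨φ, hφ, Sum.rec H (eq_crossingColors hop hφ (by ring) (isColoring_neg_iff.1 hcC)
      (hj.symm.trans (H _)) (.inr (hj'.symm.trans (H _))))⟩
    all_goals simp only [corner, Sum.elim_inl, Sum.elim_inr, crossingColors]; linarith
  | @left_pos T _ _ _ ih =>
    obtain ⟨n, hn⟩ := ih
    have h1 := hn.north_east
    have h2 := hn.south_west
    have h3 := hn.south_east
    refine ⟨Sum.elim (crossingColors (n (T.corner .NW)) (2 * n (T.corner .NW) - n (T.corner .SW))
      (n (T.corner .SW))) n, fun hφ => ?_, fun hop c hc => ?_, ?_, ?_, ?_⟩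
    · exact isColoring_hsum_iff.2 ⟨isColoring_pos_iff.2 (isColoring_crossingColors hφ (sub_sub_cancel _ _)), hn.isColoring hφ,
        rfl, rfl⟩
    · obtain ⟨hcC, hcT, hj, hj'⟩ := isColoring_hsum_iff.1 hc
      obtain ⟨φ, hφ, H⟩ := hn.factors hop hcT
      exact ⟨φ, hφ, Sum.rec (eq_crossingColors hop hφ (by ring) (isColoring_pos_iff.1 hcC)
      (hj.trans (H _)) (.inr (hj'.trans (H _)))) H⟩
    all_goals simp only [corner, Sum.elim_inl, Sum.elim_inr, crossingColors]; linarith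
  | @left_neg T _ _ _ ih =>
    obtain ⟨n, hn⟩ := ih
    have h1 := hn.north_east
    have h2 := hn.south_west
    have h3 := hn.south_east
    refine ⟨Sum.elim (crossingColors (n (T.corner .SW)) (n (T.corner .NW))
      (2 * n (T.corner .SW) - n (T.corner .NW))) n, fun hφ => ?_, fun hop c hc => ?_, ?_, ?_, ?_⟩
    · exact isColoring_hsum_iff.2 ⟨isColoring_neg_iff.2 (isColoring_crossingColors hφ rfl), hn.isColoring hφ,
        rfl, rfl⟩
    · obtain ⟨hcC, hcT, hj, hj'⟩ := isColoring_hsum_iff.1 hc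
      obtain ⟨φ, hφ, H⟩ := hn.factors hop hcT
      exact ⟨φ, hφ, Sum.rec (eq_crossingColors hop hφ rfl (isColoring_neg_iff.1 hcC)
      (hj'.trans (H _)) (.inl (hj.trans (H _)))) H⟩
    all_goals simp only [corner, Sum.elim_inl, Sum.elim_inr, crossingColors]; linarith
  | @bottom_pos T _ _ _ ih =>
    obtain ⟨n, hn⟩ := ih
    have h1 := hn.north_east
    have h2 := hn.south_west
    have h3 := hn.south_east
    refine ⟨Sum.elim n (crossingColors (n (T.corner .SE)) (n (T.corner .SW))
      (2 * n (T.corner .SE) - n (T.corner .SW))), fun hφ => ?_, fun hop c hc => ?_, ?_, ?_, ?_⟩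
    · exact isColoring_vsum_iff.2 ⟨hn.isColoring hφ, isColoring_pos_iff.2 (isColoring_crossingColors hφ rfl),
        rfl, rfl⟩
    · obtain ⟨hcT, hcC, hj, hj'⟩ := isColoring_vsum_iff.1 hc
      obtain ⟨φ, hφ, H⟩ := hn.factors hop hcT
      exact ⟨φ, hφ, Sum.rec H (eq_crossingColors hop hφ rfl (isColoring_pos_iff.1 hcC)
      (hj'.symm.trans (H _)) (.inl (hj.symm.trans (H _))))⟩
    all_goals simp only [corner, Sum.elim_inl, Sum.elim_inr, crossingColors]; linarith
  | @bottom_neg T _ _ _ ih =>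
    obtain ⟨n, hn⟩ := ih
    have h1 := hn.north_east
    have h2 := hn.south_west
    have h3 := hn.south_east
    refine ⟨Sum.elim n (crossingColors (n (T.corner .SW)) (n (T.corner .SE))
      (2 * n (T.corner .SW) - n (T.corner .SE))), fun hφ => ?_, fun hop c hc => ?_, ?_, ?_, ?_⟩
    · exact isColoring_vsum_iff.2 ⟨hn.isColoring hφ, isColoring_neg_iff.2 (isColoring_crossingColors hφ rfl),
        rfl, rfl⟩
    · obtain ⟨hcT, hcC, hj, hj'⟩ := isColoring_vsum_iff.1 hc
      obtain ⟨φ, hφ, H⟩ := hn.factors hop hcT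
      exact ⟨φ, hφ, Sum.rec H (eq_crossingColors hop hφ rfl (isColoring_neg_iff.1 hcC)
      (hj.symm.trans (H _)) (.inl (hj'.symm.trans (H _))))⟩
    all_goals simp only [corner, Sum.elim_inl, Sum.elim_inr, crossingColors]; linarith
  | @top_pos T _ _ _ ih =>
    obtain ⟨n, hn⟩ := ih
    have h1 := hn.north_east
    have h2 := hn.south_west
    have h3 := hn.south_east
    refine ⟨Sum.elim (crossingColors (n (T.corner .NW)) (2 * n (T.corner .NW) - n (T.corner .NE))
      (n (T.corner .NE))) n, fun hφ => ?_, fun hop c hc => ?_, ?_, ?_, ?_⟩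
    · exact isColoring_vsum_iff.2 ⟨isColoring_pos_iff.2 (isColoring_crossingColors hφ (sub_sub_cancel _ _)), hn.isColoring hφ,
        rfl, rfl⟩
    · obtain ⟨hcC, hcT, hj, hj'⟩ := isColoring_vsum_iff.1 hc
      obtain ⟨φ, hφ, H⟩ := hn.factors hop hcT
      exact ⟨φ, hφ, Sum.rec (eq_crossingColors hop hφ (by ring) (isColoring_pos_iff.1 hcC)
      (hj.trans (H _)) (.inr (hj'.trans (H _)))) H⟩
    all_goals simp only [corner, Sum.elim_inl, Sum.elim_inr, crossingColors]; linarith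
  | @top_neg T _ _ _ ih =>
    obtain ⟨n, hn⟩ := ih
    have h1 := hn.north_east
    have h2 := hn.south_west
    have h3 := hn.south_east
    refine ⟨Sum.elim (crossingColors (n (T.corner .NE)) (2 * n (T.corner .NE) - n (T.corner .NW))
      (n (T.corner .NW))) n, fun hφ => ?_, fun hop c hc => ?_, ?_, ?_, ?_⟩
    · exact isColoring_vsum_iff.2 ⟨isColoring_neg_iff.2 (isColoring_crossingColors hφ (sub_sub_cancel _ _)), hn.isColoring hφ,
        rfl, rfl⟩
    · obtain ⟨hcC, hcT, hj, hj'⟩ := isColoring_vsum_iff.1 hc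
      obtain ⟨φ, hφ, H⟩ := hn.factors hop hcT
      exact ⟨φ, hφ, Sum.rec (eq_crossingColors hop hφ (by ring) (isColoring_neg_iff.1 hcC)
      (hj'.trans (H _)) (.inr (hj.trans (H _)))) H⟩
    all_goals simp only [corner, Sum.elim_inl, Sum.elim_inr, crossingColors]; linarith

theorem IsRational.isCoprime {T : TangleDiagram} {a b : ℤ} (h : T.IsRational a b) :
    IsCoprime a b := by
  induction h with
  | zero => exact isCoprime_one_right
  | infty => exact isCoprime_one_left
  | right_pos _ ih => simpa using ih.add_mul_left_left 1
  | left_pos _ ih => simpa using ih.add_mul_left_left 1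
  | right_neg _ ih => simpa [sub_eq_add_neg] using ih.add_mul_left_left (-1)
  | left_neg _ ih => simpa [sub_eq_add_neg] using ih.add_mul_left_left (-1)
  | bottom_pos _ ih => simpa using ih.add_mul_left_right 1
  | top_pos _ ih => simpa using ih.add_mul_left_right 1
  | bottom_neg _ ih => simpa [sub_eq_add_neg] using ih.add_mul_left_right (-1)
  | top_neg _ ih => simpa [sub_eq_add_neg] using ih.add_mul_left_right (-1)

/-- Both fractions are in lowest terms, so `(a, b) = ±(p, q)`; the sign `r` and a translation are
absorbed by `IsUniversalColoring.affine`. -/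
theorem IsRationalTangle.exists_isUniversalColoring {T : TangleDiagram} {p q : ℤ}
    (hcop : IsCoprime p q) (hq : 0 < q) (h : T.IsRationalTangle ((p : ℚ) / q)) :
    ∃ n, T.IsUniversalColoring p q n ∧ n (T.corner .NW) = 0 := by
  obtain ⟨a, b, hT, hb, hr⟩ := h
  have hab := hT.isCoprime
  have hcross : p * b = a * q := by
    rw [div_eq_div_iff (by exact_mod_cast hq.ne') (by exact_mod_cast hb)] at hr
    exact_mod_cast hr
  have h1 : q ∣ b := hcop.symm.dvd_of_dvd_mul_left ⟨a, by rw [hcross]; ring⟩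
  have h2 : b ∣ q := hab.symm.dvd_of_dvd_mul_left ⟨p, by rw [← hcross]; ring⟩
  obtain ⟨n, hn⟩ := hT.exists_isUniversalColoring
  obtain ⟨r, hr, hrb⟩ : ∃ r : ℤ, r * r = 1 ∧ r * b = q := by
    rcases Int.natAbs_eq_natAbs_iff.1 (Int.natAbs_eq_of_dvd_dvd h1 h2) with h | h
    · exact ⟨1, rfl, by linarith⟩
    · exact ⟨-1, rfl, by linarith⟩
  have hra : r * a = p := by
    apply mul_right_cancel₀ hq.ne'
    linear_combination p * hrb - r * hcross
  refine ⟨_, hra ▸ hrb ▸ hn.affine r (-(r * n (T.corner .NW))) hr, by ring⟩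

theorem isRational_halfTwists (e : ℤ) : (halfTwists e).IsRational (-e) 1 := by
  have hneg : ∀ n : ℕ, (row neg n).IsRational (-n) 1 := by
    intro n
    induction n with
    | zero => exact .zero
    | succ n ih => simpa [row, add_comm, sub_eq_add_neg] using ih.right_neg
  have hpos : ∀ n : ℕ, (row pos n).IsRational n 1 := by
    intro n
    induction n with
    | zero => exact .zero
    | succ n ih => simpa [row, add_comm] using ih.right_pos
  unfold halfTwists
  split_ifs with h
  · convert hneg e.toNat using 1; omega
  · convert hpos (-e).toNat using 1; omega

end TangleDiagram
/-! ## The model -/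

namespace PrismQuandle

/-- The operation on the indices of the two families `z i` and `a l` of elements of the
involutory quandle of a `(2, 2, r)`-Montesinos link. -/
def indexOp (q s : ℤ) : ℤ ⊕ ℤ → ℤ ⊕ ℤ → ℤ ⊕ ℤ
  | .inl i, .inl j => .inl (2 * j - i)
  | .inl i, .inr l => .inl (2 * q * l - q - (2 * q * s - 1) * i)
  | .inr j, .inl i => .inr (2 * s * i + 1 - j)
  | .inr j, .inr l => .inr (2 * l - j)

/-- Reduction of the indices modulo `2 * q * d` and `2 * d`. -/
def reduce (q d : ℤ) : ℤ ⊕ ℤ → ZMod (2 * q * d).natAbs ⊕ ZMod (2 * d).natAbs :=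
  Sum.map Int.cast Int.cast

/-- The indices modulo `2 * q * d` and `2 * d`. -/
def Model (q d : ℤ) : Type := Quotient (Setoid.ker (reduce q d))

theorem intCast_eq_iff {n i j : ℤ} :
    (i : ZMod n.natAbs) = (j : ZMod n.natAbs) ↔ ∃ u, j = i + n * u := by
  rw [ZMod.intCast_eq_intCast_iff_dvd_sub, Int.natCast_natAbs, abs_dvd]
  exact exists_congr fun u => by constructor <;> intro h <;> linarith

theorem reduce_inl_eq {q d i j u : ℤ} (h : j = i + 2 * q * d * u) :
    reduce q d (.inl i) = reduce q d (.inl j) :=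
  congrArg Sum.inl (intCast_eq_iff.2 ⟨u, h⟩)

theorem reduce_inr_eq {q d i j u : ℤ} (h : j = i + 2 * d * u) :
    reduce q d (.inr i) = reduce q d (.inr j) :=
  congrArg Sum.inr (intCast_eq_iff.2 ⟨u, h⟩)

theorem reduce_eq_iff {q d : ℤ} {x y : ℤ ⊕ ℤ} : reduce q d x = reduce q d y ↔
    Sum.LiftRel (fun i j => ∃ u, j = i + 2 * q * d * u) (fun i j => ∃ u, j = i + 2 * d * u)
      x y := by
  rcases x with i | i <;> rcases y with j | j <;>
    simp [reduce, intCast_eq_iff]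

/-- The class of an index. -/
def mk (q d : ℤ) (x : ℤ ⊕ ℤ) : Model q d := Quotient.mk (Setoid.ker (reduce q d)) x

theorem mk_eq {q d : ℤ} {x y : ℤ ⊕ ℤ} (h : reduce q d x = reduce q d y) : mk q d x = mk q d y :=
  Quotient.sound h

/-- The operation of the model. -/
def op (q d s : ℤ) : Model q d → Model q d → Model q d :=
  Quotient.map₂ (indexOp q s) (by
    intro x x' hx y y' hy
    replace hx := reduce_eq_iff.1 hx
    replace hy := reduce_eq_iff.1 hy
    change reduce q d _ = reduce q d _
    obtain ⟨u, rfl⟩ | ⟨u, rfl⟩ := hx <;> obtain ⟨v, rfl⟩ | ⟨v, rfl⟩ := hy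
    · exact reduce_inl_eq (u := 2 * v - u) (by ring)
    · exact reduce_inl_eq (u := 2 * v - (2 * q * s - 1) * u) (by ring)
    · exact reduce_inr_eq (u := 2 * s * q * v - u) (by ring)
    · exact reduce_inr_eq (u := 2 * v - u) (by ring))

theorem op_mk (q d s : ℤ) (x y : ℤ ⊕ ℤ) :
    op q d s (mk q d x) (mk q d y) = mk q d (indexOp q s x y) := rfl

/-- The hypothesis makes `s` an inverse of `q` modulo `d`. Each witness `u` counts the multiples of
the modulus by which the two sides differ on integer representatives. -/
theorem isInvolutoryQuandleOp {q d s r : ℤ} (h : q * s = 1 + r * d) :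
    IsInvolutoryQuandleOp (op q d s) where
  idem := by
    rintro ⟨i | i⟩
    · exact mk_eq (reduce_inl_eq (u := 0) (by ring))
    · exact mk_eq (reduce_inr_eq (u := 0) (by ring))
  invol := by
    rintro ⟨i | i⟩ ⟨j | j⟩
    · exact mk_eq (reduce_inl_eq (u := 0) (by ring))
    -- The essential congruence is `(2 * q * s - 1) ^ 2 = 1 + 4 * q * s * r * d`.
    · exact mk_eq (reduce_inl_eq (u := r * (2 * j - 1) - 2 * r * s * i)
        (by linear_combination (2 * q * (2 * j - 1) - 4 * q * s * i) * h))
    · exact mk_eq (reduce_inr_eq (u := 0) (by ring))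
    · exact mk_eq (reduce_inr_eq (u := 0) (by ring))
  distrib := by
    rintro ⟨i | i⟩ ⟨j | j⟩ ⟨l | l⟩
    · exact mk_eq (reduce_inl_eq (u := 0) (by ring))
    · exact mk_eq (reduce_inl_eq (u := 0) (by ring))
    · exact mk_eq (reduce_inl_eq (u := 0) (by ring))
    · exact mk_eq (reduce_inl_eq (u := -2 * r * (l - j))
        (by linear_combination (-4 * q * (l - j)) * h))
    · exact mk_eq (reduce_inr_eq (u := 0) (by ring))
    · exact mk_eq (reduce_inr_eq (u := 2 * l * r - r - 2 * s * r * j)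
        (by linear_combination (4 * l - 2 - 4 * s * j) * h))
    · exact mk_eq (reduce_inr_eq (u := 0) (by ring))
    · exact mk_eq (reduce_inr_eq (u := 0) (by ring))

/-! ### Order of the model -/

theorem reduce_surjective (q d : ℤ) : Function.Surjective (reduce q d) :=
  Sum.map_surjective.2 ⟨ZMod.intCast_surjective, ZMod.intCast_surjective⟩

/-- The model as a disjoint union of two cyclic families. -/
noncomputable def equivSum (q d : ℤ) :
    Model q d ≃ ZMod (2 * q * d).natAbs ⊕ ZMod (2 * d).natAbs :=
  Setoid.quotientKerEquivOfSurjective _ (reduce_surjective q d)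

theorem finite {q d : ℤ} (hq : q ≠ 0) (hd : d ≠ 0) : Finite (Model q d) := by
  have : NeZero (2 * q * d).natAbs := ⟨by simp [hq, hd]⟩
  have : NeZero (2 * d).natAbs := ⟨by simp [hd]⟩
  exact Finite.of_equiv _ (equivSum q d).symm

theorem card {q d : ℤ} (hq : 0 < q) (hd : d ≠ 0) :
    (Nat.card (Model q d) : ℤ) = 2 * (q + 1) * |d| := by
  have : NeZero (2 * q * d).natAbs := ⟨by simp [hq.ne', hd]⟩
  have : NeZero (2 * d).natAbs := ⟨by simp [hd]⟩
  rw [Nat.card_congr (equivSum q d), Nat.card_sum, Nat.card_zmod, Nat.card_zmod]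
  push_cast
  simp only [abs_mul, abs_of_pos hq]
  norm_num
  ring

/-! ### Dihedral sequences in the model that colour the two tangles of fraction 1/2 -/

/-- The sequence of the index `inl (q * j - m)` at `2 * j` and `inr j` at `2 * j + 1`. -/
def seqX (q m i : ℤ) : ℤ ⊕ ℤ := if Even i then .inl (q * (i / 2) - m) else .inr (i / 2)

/-- The sequence of the index `inr j` at `2 * j` and `inl (q * j)` at `2 * j + 1`. -/
def seqY (q i : ℤ) : ℤ ⊕ ℤ := if Even i then .inr (i / 2) else .inl (q * (i / 2))

theorem seqX_even (q m j : ℤ) : seqX q m (2 * j) = .inl (q * j - m) := by simp [seqX]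

theorem seqX_odd (q m j : ℤ) : seqX q m (2 * j + 1) = .inr j := by
  have : (2 * j + 1) / 2 = j := by omega
  simp [seqX, this]

theorem seqY_even (q j : ℤ) : seqY q (2 * j) = .inr j := by simp [seqY]

theorem seqY_odd (q j : ℤ) : seqY q (2 * j + 1) = .inl (q * j) := by
  have : (2 * j + 1) / 2 = j := by omega
  simp [seqY, this]

theorem isDihedral_inl (q d s : ℤ) : IsDihedral (op q d s) fun i => mk q d (.inl i) :=
  fun _ _ => rfl

theorem isDihedral_inr (q d s : ℤ) : IsDihedral (op q d s) fun i => mk q d (.inr i) :=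
  fun _ _ => rfl

theorem isDihedral_seqY {q d s r : ℤ} (h : q * s = 1 + r * d) :
    IsDihedral (op q d s) fun i => mk q d (seqY q i) := by
  intro i j
  dsimp only
  obtain ⟨i, rfl | rfl⟩ := Int.even_or_odd' i <;> obtain ⟨j, rfl | rfl⟩ := Int.even_or_odd' j
  · rw [show 2 * (2 * j) - 2 * i = 2 * (2 * j - i) by ring]
    simp only [seqY_even, op_mk]
    exact mk_eq (reduce_inr_eq (u := 0) (by ring))
  · rw [show 2 * (2 * j + 1) - 2 * i = 2 * (2 * j + 1 - i) by ring]
    simp only [seqY_even, seqY_odd, op_mk]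
    exact mk_eq (reduce_inr_eq (u := r * j) (by linear_combination 2 * j * h))
  · rw [show 2 * (2 * j) - (2 * i + 1) = 2 * (2 * j - i - 1) + 1 by ring]
    simp only [seqY_even, seqY_odd, op_mk]
    exact mk_eq (reduce_inl_eq (u := -r * i) (by linear_combination -2 * q * i * h))
  · rw [show 2 * (2 * j + 1) - (2 * i + 1) = 2 * (2 * j - i) + 1 by ring]
    simp only [seqY_odd, op_mk]
    exact mk_eq (reduce_inl_eq (u := 0) (by ring))

theorem isDihedral_seqX {q d s r m : ℤ} (h : q * s = 1 + r * d) (hm : m = q - d) :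
    IsDihedral (op q d s) fun i => mk q d (seqX q m i) := by
  intro i j
  dsimp only
  obtain ⟨i, rfl | rfl⟩ := Int.even_or_odd' i <;> obtain ⟨j, rfl | rfl⟩ := Int.even_or_odd' j
  · rw [show 2 * (2 * j) - 2 * i = 2 * (2 * j - i) by ring]
    simp only [seqX_even, op_mk]
    exact mk_eq (reduce_inl_eq (u := 0) (by ring))
  · rw [show 2 * (2 * j + 1) - 2 * i = 2 * (2 * j + 1 - i) by ring]
    simp only [seqX_even, seqX_odd, op_mk]
    exact mk_eq (reduce_inl_eq (u := -r * i + r - s)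
      (by subst hm; linear_combination (-2 * q * i + 2 * q) * h))
  · rw [show 2 * (2 * j) - (2 * i + 1) = 2 * (2 * j - i - 1) + 1 by ring]
    simp only [seqX_even, seqX_odd, op_mk]
    exact mk_eq (reduce_inr_eq (u := r * j - r + s)
      (by subst hm; linear_combination (2 * j - 2) * h))
  · rw [show 2 * (2 * j + 1) - (2 * i + 1) = 2 * (2 * j - i) + 1 by ring]
    simp only [seqX_odd, op_mk]
    exact mk_eq (reduce_inr_eq (u := 0) (by ring))

end PrismQuandle

/-! ## The presentation by dihedral sequences -/

/-- Four dihedral sequences, with the identifications that hold between the colours of the corners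
in a `(2, 2, p / q)`-Montesinos diagram. -/
structure IsMontesinosSystem {X : Type} (op : X → X → X) (p q e : ℤ) (w x y z : ℤ → X) :
    Prop where
  isInvolutoryQuandleOp : IsInvolutoryQuandleOp op
  isDihedral_w : IsDihedral op w
  isDihedral_x : IsDihedral op x
  isDihedral_y : IsDihedral op y
  isDihedral_z : IsDihedral op z
  x_zero : w (-e) = x 0
  x_two : w (-e + 1) = x 2
  y_zero : x 1 = y 0
  y_two : x (1 + 2) = y 2
  z_zero : y 1 = z 0
  z_q : y (1 + 2) = z q
  w_zero : z p = w 0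
  w_one : z (p + q) = w 1

/-- The indices `q * a + m * b` with `b = 0` and `b = -1` generate all others by reflections. -/
theorem Int.lattice_reflection_induction {P : ℤ → ℤ → Prop}
    (h : ∀ a b a' b', P a b → P a' b' → P (2 * a' - a) (2 * b' - b))
    (h0 : ∀ a, P a 0) (h1 : ∀ a, P a (-1)) (a b : ℤ) : P a b := by
  have step : ∀ i j, (∀ a, P a i) → (∀ a, P a j) → ∀ a, P a (2 * j - i) :=
    fun i j hi hj a => by convert h a i a j (hi a) (hj a) using 1; ring
  exact Int.reflection_induction (P := fun b => ∀ a, P a b) step h0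
    (by simpa using step _ _ h1 h0) b a

namespace IsMontesinosSystem

variable {X : Type} {op : X → X → X} {p q e m d r s : ℤ} {w x y z : ℤ → X}

/-- Each pair of gluing relations equates two dihedral sequences at `0` and `1`, hence everywhere;
the next three lemmas use the same principle. -/
theorem w_eq (h : IsMontesinosSystem op p q e w x y z) (j : ℤ) : w j = z (q * j + p) :=
  h.isDihedral_w.ext (h.isDihedral_z.comp_affine q p)
    (by rw [← h.w_zero]; congr 1; ring) (by rw [← h.w_one]; congr 1; ring) j

theorem x_even (h : IsMontesinosSystem op p q e w x y z) (hm : m = e * q - p) (j : ℤ) :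
    x (2 * j) = z (q * j - m) := by
  have := (h.isDihedral_x.comp_affine 2 0).ext (h.isDihedral_z.comp_affine q (-m))
    (by
      simp only [mul_zero, add_zero, zero_add]
      rw [← h.x_zero, h.w_eq, hm]; congr 1; ring)
    (by
      simp only [mul_one, add_zero]
      rw [← h.x_two, h.w_eq, hm]; congr 1; ring) j
  simpa [sub_eq_add_neg] using this

theorem y_odd (h : IsMontesinosSystem op p q e w x y z) (j : ℤ) : y (2 * j + 1) = z (q * j) := by
  have := (h.isDihedral_y.comp_affine 2 1).ext (h.isDihedral_z.comp_affine q 0)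
    (by simpa using h.z_zero) (by simpa using h.z_q) j
  simpa using this

theorem x_odd (h : IsMontesinosSystem op p q e w x y z) (j : ℤ) : x (2 * j + 1) = y (2 * j) := by
  have := (h.isDihedral_x.comp_affine 2 1).ext (h.isDihedral_y.comp_affine 2 0)
    (by simpa using h.y_zero) (by simpa using h.y_two) j
  simpa using this

/-- For `b = 0` the product takes place inside the sequence `y`, for `b = -1` inside `x`. The
symmetry at `y (2 * l)` is an automorphism, so these two rows determine it on the whole lattice. -/
theorem op_z_y (h : IsMontesinosSystem op p q e w x y z) (hm : m = e * q - p) (a b l : ℤ) :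
    op (z (q * a + m * b)) (y (2 * l)) = z (q * (2 * l - a - 1) - (2 * q - m) * b) := by
  refine Int.lattice_reflection_induction
    (P := fun a b => op (z (q * a + m * b)) (y (2 * l)) =
      z (q * (2 * l - a - 1) - (2 * q - m) * b)) ?_ ?_ ?_ a b
  · intro a b a' b' h1 h2
    rw [show q * (2 * a' - a) + m * (2 * b' - b) =
      2 * (q * a' + m * b') - (q * a + m * b) by ring, h.isDihedral_z,
      h.isInvolutoryQuandleOp.distrib, h1, h2, ← h.isDihedral_z]
    congr 1; ring
  · intro a
    rw [mul_zero, add_zero, ← h.y_odd, ← h.isDihedral_y, mul_zero, sub_zero, ← h.y_odd]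
    congr 1; ring
  · intro a
    rw [show q * a + m * (-1) = q * a - m by ring, ← h.x_even hm, ← h.x_odd, ← h.isDihedral_x,
      show q * (2 * l - a - 1) - (2 * q - m) * (-1) = q * (2 * l - a + 1) - m by ring,
      ← h.x_even hm]
    congr 1; ring

/-- The rows `b = 0` and `b = -1` again lie in `y` and `x`; other rows follow because the symmetry
at `u ▷ v` is that at `u` conjugated by that at `v`. -/
theorem op_y_z (h : IsMontesinosSystem op p q e w x y z) (hm : m = e * q - p) (a b j : ℤ) :
    op (y (2 * j)) (z (q * a + m * b)) = y (2 * (2 * a + 2 * b + 1 - j)) := by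
  refine Int.lattice_reflection_induction
    (P := fun a b => ∀ j, op (y (2 * j)) (z (q * a + m * b)) =
      y (2 * (2 * a + 2 * b + 1 - j))) ?_ ?_ ?_ a b j
  · intro a b a' b' h1 h2 j
    have conj : ∀ u v t, op t (op u v) = op (op (op t v) u) v := fun u v t => by
      rw [h.isInvolutoryQuandleOp.distrib (op t v) u v, h.isInvolutoryQuandleOp.invol]
    rw [show q * (2 * a' - a) + m * (2 * b' - b) =
      2 * (q * a' + m * b') - (q * a + m * b) by ring, h.isDihedral_z, conj, h2, h1, h2]
    congr 1; ring
  · intro a j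
    rw [mul_zero, add_zero, ← h.y_odd, ← h.isDihedral_y]
    congr 1; ring
  · intro a j
    rw [show q * a + m * (-1) = q * a - m by ring, ← h.x_even hm, ← h.x_odd, ← h.x_odd,
      ← h.isDihedral_x]
    congr 1; ring

/-- The Bézout relation `hrs` provides the coordinates `a = (s - r) * i`, `b = r * i` of the index
`i`, with `a + b = s * i`. -/
theorem op_z_y' (h : IsMontesinosSystem op p q e w x y z) (hm : m = e * q - p)
    (hrs : r * m + (s - r) * q = 1) (i l : ℤ) :
    op (z i) (y (2 * l)) = z (2 * q * l - q - (2 * q * s - 1) * i) := by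
  have := h.op_z_y hm ((s - r) * i) (r * i) l
  rw [show q * ((s - r) * i) + m * (r * i) = i by linear_combination i * hrs] at this
  rw [this]
  congr 1
  linear_combination i * hrs

theorem op_y_z' (h : IsMontesinosSystem op p q e w x y z) (hm : m = e * q - p)
    (hrs : r * m + (s - r) * q = 1) (i j : ℤ) :
    op (y (2 * j)) (z i) = y (2 * (2 * s * i + 1 - j)) := by
  have := h.op_y_z hm ((s - r) * i) (r * i) j
  rw [show q * ((s - r) * i) + m * (r * i) = i by linear_combination i * hrs] at this
  rw [this]
  congr 1
  ring

/-- Replacing `(a, b)` by `(a + m, b - q)` leaves `q * a + m * b` unchanged but shifts the index on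
the right of `op_z_y` by `2 * q * d`. -/
theorem z_periodic (h : IsMontesinosSystem op p q e w x y z) (hm : m = e * q - p)
    (hrs : r * m + (s - r) * q = 1) (hd : d = q - m) :
    Function.Periodic z (2 * q * d) := by
  intro i
  -- These coordinates are chosen so that the right-hand side is `z i`.
  have h1 := h.op_z_y hm (-(s + r) * (i + q)) (r * (i + q)) 0
  have h2 := h.op_z_y hm (-(s + r) * (i + q) + m) (r * (i + q) - q) 0
  rw [show q * (-(s + r) * (i + q) + m) + m * (r * (i + q) - q) =
    q * (-(s + r) * (i + q)) + m * (r * (i + q)) by ring, h1] at h2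
  rw [show i + 2 * q * d = q * (2 * 0 - (-(s + r) * (i + q) + m) - 1) -
      (2 * q - m) * (r * (i + q) - q) by subst hd; linear_combination (-(i + q)) * hrs, ← h2]
  congr 1
  linear_combination (i + q) * hrs

theorem y_periodic (h : IsMontesinosSystem op p q e w x y z) (hm : m = e * q - p)
    (hd : d = q - m) (j u : ℤ) : y (2 * (j + 2 * d * u)) = y (2 * j) := by
  have : Function.Periodic (fun j => y (2 * j)) (2 * d) := by
    intro j
    have h1 := h.op_y_z hm 0 0 (1 - j)
    -- The index `0` has coordinates `(0, 0)` and `(-m, q)`, whose sums differ by `d`.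
    have h2 := h.op_y_z hm (-m) q (1 - j)
    rw [show q * -m + m * q = q * 0 + m * 0 by ring, h1] at h2
    convert h2.symm using 2
    · subst hd; ring
    · ring
  simpa [mul_comm] using this.int_mul u j

/-- The homomorphism from the model. -/
def ofModel (h : IsMontesinosSystem op p q e w x y z) (hm : m = e * q - p)
    (hrs : r * m + (s - r) * q = 1) (hd : d = q - m) : PrismQuandle.Model q d → X :=
  Quotient.lift (Sum.elim z fun l => y (2 * l)) (by
    intro a b hab
    obtain ⟨u, rfl⟩ | ⟨u, rfl⟩ := PrismQuandle.reduce_eq_iff.1 hab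
    · have := (h.z_periodic hm hrs hd).int_mul u
      simpa [mul_comm] using (this _).symm
    · exact (h.y_periodic hm hd _ u).symm)

theorem ofModel_op (h : IsMontesinosSystem op p q e w x y z) (hm : m = e * q - p)
    (hrs : r * m + (s - r) * q = 1) (hd : d = q - m) (a b : PrismQuandle.Model q d) :
    h.ofModel hm hrs hd (PrismQuandle.op q d s a b) =
      op (h.ofModel hm hrs hd a) (h.ofModel hm hrs hd b) := by
  obtain ⟨i | i⟩ := a <;> obtain ⟨j | j⟩ := b
  · exact h.isDihedral_z i j
  · exact (h.op_z_y' hm hrs i j).symm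
  · exact (h.op_y_z' hm hrs j i).symm
  · have := h.isDihedral_y.comp_affine 2 0 i j
    simp only [add_zero] at this
    exact this

theorem ofModel_seqX (h : IsMontesinosSystem op p q e w x y z) (hm : m = e * q - p)
    (hrs : r * m + (s - r) * q = 1) (hd : d = q - m) (i : ℤ) :
    h.ofModel hm hrs hd (PrismQuandle.mk q d (PrismQuandle.seqX q m i)) = x i := by
  obtain ⟨i, rfl | rfl⟩ := Int.even_or_odd' i
  · rw [PrismQuandle.seqX_even, h.x_even hm]; rfl
  · rw [PrismQuandle.seqX_odd, h.x_odd]; rfl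

theorem ofModel_seqY (h : IsMontesinosSystem op p q e w x y z) (hm : m = e * q - p)
    (hrs : r * m + (s - r) * q = 1) (hd : d = q - m) (i : ℤ) :
    h.ofModel hm hrs hd (PrismQuandle.mk q d (PrismQuandle.seqY q i)) = y i := by
  obtain ⟨i, rfl | rfl⟩ := Int.even_or_odd' i
  · rw [PrismQuandle.seqY_even]; rfl
  · rw [PrismQuandle.seqY_odd, h.y_odd]; rfl

end IsMontesinosSystem
/-! ## Montesinos diagrams -/

namespace TangleDiagram

theorem isColoring_numeratorClosure {X : Type} {op : X → X → X} {T : TangleDiagram}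
    {c : T.numeratorClosure.Arc → X}
    (h : IsColoring op T fun t => c (Quot.mk _ t)) : T.numeratorClosure.IsColoring op c := by
  intro k hk
  obtain ⟨k', hk', rfl⟩ := List.mem_map.1 hk
  exact h.crossing k' hk'

theorem isColoring_gen {T : TangleDiagram} :
    IsColoring LinkDiagram.InvolutoryQuandle.op T
      fun t => LinkDiagram.InvolutoryQuandle.gen (D := T.numeratorClosure) (Quot.mk _ t) where
  join _ _ h := congrArg _ (Quot.sound (.inl h))
  crossing k hk :=
    LinkDiagram.InvolutoryQuandle.isColoring_gen (k.map _) (List.mem_map_of_mem hk)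

theorem gen_NW_eq_NE (T : TangleDiagram) :
    LinkDiagram.InvolutoryQuandle.gen (D := T.numeratorClosure) (Quot.mk _ (T.corner .NW)) =
      LinkDiagram.InvolutoryQuandle.gen (Quot.mk _ (T.corner .NE)) :=
  congrArg _ (Quot.sound (.inr (.inl ⟨rfl, rfl⟩)))

theorem gen_SW_eq_SE (T : TangleDiagram) :
    LinkDiagram.InvolutoryQuandle.gen (D := T.numeratorClosure) (Quot.mk _ (T.corner .SW)) =
      LinkDiagram.InvolutoryQuandle.gen (Quot.mk _ (T.corner .SE)) :=
  congrArg _ (Quot.sound (.inr (.inr ⟨rfl, rfl⟩)))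

/-- A colouring of the pieces that is compatible with the closure colours the arcs. -/
def closureColoring {X : Type} {op : X → X → X} {T : TangleDiagram} {c : T.Piece → X}
    (h : IsColoring op T c) (hN : c (T.corner .NW) = c (T.corner .NE))
    (hS : c (T.corner .SW) = c (T.corner .SE)) : T.numeratorClosure.Arc → X :=
  Quot.lift c (by
    rintro a b (h' | ⟨rfl, rfl⟩ | ⟨rfl, rfl⟩)
    · exact h.join a b h'
    · exact hN
    · exact hS)

end TangleDiagram

open TangleDiagram LinkDiagram.InvolutoryQuandle in
/-- The involutory quandle of a `(2, 2, p / q)`-Montesinos diagram is the model. -/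
theorem exists_bijective_toModel {p q e : ℤ} (hq : 0 < q) (hcop : IsCoprime p q)
    {L : LinkDiagram} (hL : IsMontesinosDiagram L (1 / 2) (1 / 2) ((p : ℚ) / q) e) :
    ∃ f : L.InvolutoryQuandle → PrismQuandle.Model q (q - (e * q - p)),
      Function.Bijective f := by
  obtain ⟨T₁, T₂, T₃, h₁, h₂, h₃, rfl⟩ := hL
  have half : IsCoprime (1 : ℤ) 2 := isCoprime_one_left
  obtain ⟨n₀, u₀⟩ := (isRational_halfTwists e).exists_isUniversalColoring
  obtain ⟨n₀, u₀, c₀⟩ : ∃ n, (halfTwists e).IsUniversalColoring (-e) 1 n ∧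
      n ((halfTwists e).corner .NW) = 0 :=
    ⟨_, by simpa using u₀.affine 1 (-n₀ ((halfTwists e).corner .NW)) rfl, by simp⟩
  obtain ⟨n₁, u₁, c₁⟩ :=
    IsRationalTangle.exists_isUniversalColoring half two_pos (by simpa using h₁)
  obtain ⟨n₂, u₂, c₂⟩ :=
    IsRationalTangle.exists_isUniversalColoring half two_pos (by simpa using h₂)
  obtain ⟨n₃, u₃, c₃⟩ := IsRationalTangle.exists_isUniversalColoring hcop hq h₃
  have a₀ := u₀.north_east
  have b₀ := u₀.south_west
  have d₀ := u₀.south_east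
  have a₁ := u₁.north_east
  have b₁ := u₁.south_west
  have d₁ := u₁.south_east
  have a₂ := u₂.north_east
  have b₂ := u₂.south_west
  have d₂ := u₂.south_east
  have a₃ := u₃.north_east
  have b₃ := u₃.south_west
  have d₃ := u₃.south_east
  rw [c₀] at a₀ b₀ d₀
  rw [c₁] at a₁ b₁ d₁
  rw [c₂] at a₂ b₂ d₂
  rw [c₃] at a₃ b₃ d₃
  simp only [zero_add] at a₀ b₀ d₀ a₁ b₁ d₁ a₂ b₂ d₂ a₃ b₃ d₃
  set T := hsum (halfTwists e) (hsum T₁ (hsum T₂ T₃)) with hT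
  change ∃ f : T.numeratorClosure.InvolutoryQuandle → _, _
  -- The tautological colouring by `Q₂(L)` itself is cut into colourings of the four tangles.
  obtain ⟨g₀, g', j₁, j₂⟩ := isColoring_hsum_iff.1 (isColoring_gen (T := T))
  obtain ⟨g₁, g', j₃, j₄⟩ := isColoring_hsum_iff.1 g'
  obtain ⟨g₂, g₃, j₅, j₆⟩ := isColoring_hsum_iff.1 g'
  have j₇ := gen_NW_eq_NE T
  have j₈ := gen_SW_eq_SE T
  have hop := isInvolutoryQuandleOp (D := T.numeratorClosure)
  obtain ⟨w, hw, hw'⟩ := u₀.factors hop g₀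
  obtain ⟨x, hx, hx'⟩ := u₁.factors hop g₁
  obtain ⟨y, hy, hy'⟩ := u₂.factors hop g₂
  obtain ⟨z, hz, hz'⟩ := u₃.factors hop g₃
  have sys : IsMontesinosSystem op p q e w x y z := by
    simp only [corner] at j₁ j₂ j₃ j₄ j₅ j₆ j₇ j₈
    constructor
    · exact hop
    · exact hw
    · exact hx
    · exact hy
    · exact hz
    · rw [← a₀, ← c₁, ← hw', ← hx']; exact j₁
    · rw [← d₀, ← b₁, ← hw', ← hx']; exact j₂
    · rw [← a₁, ← c₂, ← hx', ← hy']; exact j₃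
    · rw [← d₁, ← b₂, ← hx', ← hy']; exact j₄
    · rw [← a₂, ← c₃, ← hy', ← hz']; exact j₅
    · rw [← d₂, ← b₃, ← hy', ← hz']; exact j₆
    · rw [← a₃, ← c₀, ← hw', ← hz']; exact j₇.symm
    · rw [← d₃, ← b₀, ← hw', ← hz']; exact j₈.symm
  obtain ⟨m, hm⟩ : ∃ m, m = e * q - p := ⟨_, rfl⟩
  rw [← hm]
  obtain ⟨d, hd⟩ : ∃ d, d = q - m := ⟨_, rfl⟩
  rw [← hd]
  obtain ⟨r, s, hrs⟩ : ∃ r s : ℤ, r * m + (s - r) * q = 1 := by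
    obtain ⟨a, b, hab⟩ := hcop
    -- Since `m = e * q - p`, a Bézout relation for `p, q` becomes one for `m, q`.
    exact ⟨-a, b + a * e - a, by subst hm; linear_combination hab⟩
  have hqs : q * s = 1 + r * d := by subst hd; linear_combination hrs
  have hmop := PrismQuandle.isInvolutoryQuandleOp hqs
  set ι := PrismQuandle.mk q d with hι
  set W : ℤ → PrismQuandle.Model q d := fun i => ι (.inl (q * i + p)) with hW
  -- These are the colours forced by `w_eq`, `x_even`, `x_odd` and `y_odd`, with the generic `z` and
  -- `y (2 * l)` replaced by the two families of the model.
  set c : T.Piece → PrismQuandle.Model q d :=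
    Sum.elim (fun t => W (n₀ t)) (Sum.elim (fun t => ι (PrismQuandle.seqX q m (n₁ t)))
      (Sum.elim (fun t => ι (PrismQuandle.seqY q (n₂ t))) fun t => ι (.inl (n₃ t)))) with hc
  have X_even := PrismQuandle.seqX_even q m
  have X_odd := PrismQuandle.seqX_odd q m
  have Y_even := PrismQuandle.seqY_even q
  have Y_odd := PrismQuandle.seqY_odd q
  have X0 := X_even 0
  have X2 := X_even 1
  have X1 := X_odd 0
  have X3 := X_odd 1
  have Y0 := Y_even 0
  have Y2 := Y_even 1
  have Y1 := Y_odd 0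
  have Y3 := Y_odd 1
  norm_num at X0 X1 X2 X3 Y0 Y1 Y2 Y3
  have hcT : IsColoring (PrismQuandle.op q d s) T c := by
    refine isColoring_hsum_iff.2 ⟨u₀.isColoring (φ := W) ?_, isColoring_hsum_iff.2
      ⟨u₁.isColoring (PrismQuandle.isDihedral_seqX hqs (by linarith)), isColoring_hsum_iff.2
      ⟨u₂.isColoring (PrismQuandle.isDihedral_seqY hqs),
        u₃.isColoring (PrismQuandle.isDihedral_inl q d s), ?_, ?_⟩, ?_, ?_⟩, ?_, ?_⟩
    · exact (PrismQuandle.isDihedral_inl q d s).comp_affine q p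
    all_goals simp only [hc, corner, Sum.elim_inl, Sum.elim_inr]
    · rw [a₂, c₃, Y1]
    · rw [d₂, b₃]; norm_num [Y3]
    · rw [a₁, c₂, X1, Y0]
    · rw [d₁, b₂]; norm_num [X3, Y2]
    · rw [a₀, c₁, X0, hW]; dsimp only; congr 2; rw [hm]; ring
    · rw [d₀, b₁, X2, hW]; dsimp only; congr 2; rw [hm]; ring
  have hN : c (T.corner .NW) = c (T.corner .NE) := by
    change W (n₀ ((halfTwists e).corner .NW)) = ι (.inl (n₃ (T₃.corner .NE)))
    rw [a₃, c₀, hW]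
    dsimp only
    rw [mul_zero, zero_add]
  have hS : c (T.corner .SW) = c (T.corner .SE) := by
    change W (n₀ ((halfTwists e).corner .SW)) = ι (.inl (n₃ (T₃.corner .SE)))
    rw [d₃, b₀, hW]
    dsimp only
    rw [mul_one, add_comm]
  have hcol : T.numeratorClosure.IsColoring (PrismQuandle.op q d s) (closureColoring hcT hN hS) :=
    isColoring_numeratorClosure hcT
  set f := lift hmop hcol with hf
  have f_gen : ∀ t : T.Piece, f (gen (Quot.mk _ t)) = c t := fun _ => rfl
  -- Both maps are homomorphisms, so it suffices that their composite fixes the arcs.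
  refine ⟨f, Function.LeftInverse.injective (g := sys.ofModel hm hrs hd) ?_, ?_⟩
  · refine induction ?_ ?_
    · rintro ⟨t⟩
      refine (congrArg _ (f_gen t)).trans ?_
      obtain t | t | t | t := t
      · exact (sys.w_eq _).symm.trans (hw' t).symm
      · exact (sys.ofModel_seqX hm hrs hd _).trans (hx' t).symm
      · exact (sys.ofModel_seqY hm hrs hd _).trans (hy' t).symm
      · exact (hz' t).symm
    · intro a b ha hb
      rw [hf, lift_op, sys.ofModel_op, ← hf, ha, hb]
  · have range_op : ∀ a b, a ∈ Set.range f → b ∈ Set.range f →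
        PrismQuandle.op q d s a b ∈ Set.range f := by
      rintro _ _ ⟨a, rfl⟩ ⟨b, rfl⟩
      exact ⟨op a b, lift_op _ _ _ _⟩
    have range_seq : ∀ φ : ℤ → PrismQuandle.Model q d, IsDihedral (PrismQuandle.op q d s) φ →
        φ 0 ∈ Set.range f → φ 1 ∈ Set.range f → ∀ i, φ i ∈ Set.range f := fun φ hφ h0 h1 i =>
      Int.reflection_induction (P := fun i => φ i ∈ Set.range f)
        (fun i j hi hj => by rw [hφ]; exact range_op _ _ hi hj) h0 h1 i
    have mem : ∀ t, c t ∈ Set.range f := fun t => ⟨_, f_gen t⟩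
    -- The left corners of `T₃` generate the row `b = 0` and those of `T₁` the row `b = -1`; the
    -- family `inr` will come from the left corners of `T₂`.
    have inl_mem : ∀ a b, ι (.inl (q * a + m * b)) ∈ Set.range f := by
      refine Int.lattice_reflection_induction ?_ ?_ ?_
      · intro a b a' b' h1 h2
        convert range_op _ _ h1 h2 using 1
        exact congrArg (fun i => ι (.inl i)) (by ring)
      · intro a
        rw [mul_zero]
        refine range_seq _ ((PrismQuandle.isDihedral_inl q d s).comp_affine q 0) ?_ ?_ a
        · have := mem (.inr (.inr (.inr (T₃.corner .NW))))
          simpa only [hc, Sum.elim_inr, c₃, mul_zero, add_zero] using this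
        · have := mem (.inr (.inr (.inr (T₃.corner .SW))))
          simpa only [hc, Sum.elim_inr, b₃, mul_one, add_zero] using this
      · intro a
        rw [mul_neg_one]
        refine range_seq _ ((PrismQuandle.isDihedral_inl q d s).comp_affine q (-m)) ?_ ?_ a
        · have := mem (.inr (.inl (T₁.corner .NW)))
          simpa only [hc, Sum.elim_inr, Sum.elim_inl, c₁, X0, mul_zero, zero_add] using this
        · have := mem (.inr (.inl (T₁.corner .SW)))
          simpa only [hc, Sum.elim_inr, Sum.elim_inl, b₁, X2, mul_one, sub_eq_add_neg]
            using this
    rintro ⟨i | i⟩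
    · have := inl_mem ((s - r) * i) (r * i)
      rwa [show q * ((s - r) * i) + m * (r * i) = i by linear_combination i * hrs] at this
    · refine range_seq _ (PrismQuandle.isDihedral_inr q d s) ?_ ?_ i
      · have := mem (.inr (.inr (.inl (T₂.corner .NW))))
        simpa only [hc, Sum.elim_inr, Sum.elim_inl, c₂, Y0] using this
      · have := mem (.inr (.inr (.inl (T₂.corner .SW))))
        simpa only [hc, Sum.elim_inr, Sum.elim_inl, b₂, Y2] using this

theorem theorem1 (p q : ℕ) (e : ℤ) (hp : 0 < p) (hpq : p < q) (hcop : Nat.gcd p q = 1)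
    (L : LinkDiagram) (hL : IsMontesinosDiagram L (1 / 2) (1 / 2) ((p : ℚ) / (q : ℚ)) e) :
    Finite L.InvolutoryQuandle ∧
      (Nat.card L.InvolutoryQuandle : ℤ) =
        2 * ((q : ℤ) + 1) * |(e - 1) * (q : ℤ) - (p : ℤ)| := by
  have hq : (0 : ℤ) < q := by omega
  obtain ⟨f, hf⟩ := exists_bijective_toModel (p := p) (e := e) hq
    (Nat.isCoprime_iff_coprime.2 hcop) (by simpa using hL)
  -- Finiteness needs `d ≠ 0`: otherwise `q` would divide `p`, against `0 < p < q`.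
  have hd : (q : ℤ) - (e * q - p) ≠ 0 := by
    intro h
    have hdvd : (q : ℤ) ∣ p := ⟨e - 1, by linear_combination h⟩
    exact absurd (Nat.le_of_dvd hp (Int.natCast_dvd_natCast.1 hdvd)) (by omega)
  have := PrismQuandle.finite hq.ne' hd
  refine ⟨Finite.of_injective f hf.1, ?_⟩
  rw [Nat.card_congr (Equiv.ofBijective f hf), PrismQuandle.card hq hd, ← abs_neg]
  congr 2
  ring
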